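/- Let $G$ be a countable group. A left order of $G$ is a map $\lambda : G\setminus\{e\}\to\{\pm1\}$ such that $\lambda(f)=\lambda(g)=1$ implies $fg\neq e$ and $\lambda(fg)=1$, and $\lambda(f^{-1})=-\lambda(f)$; it is identified with the left-invariant total order given by $f<_\lambda g$ iff $f\ne g$ and $\lambda(f^{-1}g)=1$. The set $LO(G)$ of left orders has the topology of pointwise convergence (as a subset of $\{\pm1\}^{G\setminus\{e\}}$), and $\lambda$ is called isolated if it is an isolated point of $LO(G)$. Given $\lambda\in LO(G)$, an enumeration without repetition $G=\{g_i\mid i\ge 1\}$ with $g_1=e$, and $x_0\in\mathbb R$, define $\iota:G\to\mathbb R$ inductively by $\iota(g_1)=x_0$ and, if $g_{i_1}<_\lambda\cdots<_\lambda g_{i_n}$ are the elements $g_1,\dots,g_n$ in increasing order, by $\iota(g_{n+1})=\iota(g_{i_1})-1$ if $g_{n+1}<_\lambda g_{i_1}$, $\iota(g_{n+1})=\iota(g_{i_n})+1$ if $g_{i_n}<_\lambda g_{n+1}$, and $\iota(g_{n+1})=\frac12(\iota(g_{i_k})+\iota(g_{i_{k+1}}))$ if $g_{i_k}<_\lambda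 g_{n+1}<_\lambda g_{i_{k+1}}$. The dynamical realization $\rho_\lambda:G\to\mathrm{Homeo}_+(\mathbb R)$ of $\lambda$ based at $x_0$ is the unique action by orientation preserving homeomorphisms with $\rho_\lambda(g)\iota(h)=\iota(gh)$ for all $g,h\in G$ for which every $\rho_\lambda(g)$ is affine on the closure of each gap of $\mathrm{Cl}(\iota(G))$. It is minimal if all its orbits are dense in $\mathbb R$. **Theorem 4.1.** Suppose that $\lambda\in LO(G)$ is isolated and that its dynamical realization $\rho_\lambda$ (for some such enumeration and some $x_0$) is minimal. Then $G$ is isomorphic to an additive subgroup $A$ of $\mathbb Q$ with $A\not\cong\mathbb Z$, and under any isomorphism $G\cong A$ the order $<_\lambda$ is either the natural order of $A\subset\mathbb Q\subset\mathbb R$ or its reverse. -/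

import Mathlib

namespace LeftOrders

variable {G : Type*} [Group G]

/-- The set of left orders of `G`, as sign functions on `G ∖ {e}`. As a subset of a product of
copies of the discrete space `{±1}` it carries the topology of pointwise convergence. -/
def LO (G : Type*) [Group G] : Set ({g : G // g ≠ 1} → ℤˣ) :=
  {s | (∀ f g : {g : G // g ≠ 1}, s f = 1 → s g = 1 →
          ∃ h : f.1 * g.1 ≠ 1, s ⟨f.1 * g.1, h⟩ = 1) ∧
       (∀ f : {g : G // g ≠ 1}, s ⟨f.1⁻¹, inv_ne_one.2 f.2⟩ = - s f)}

/-- The strict order relation on `G` of a left order `o`: `f < g` iff `f⁻¹ g` is `o`-positive. -/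
def ordLT (o : LO G) (f g : G) : Prop :=
  ∃ h : f⁻¹ * g ≠ 1, o.1 ⟨f⁻¹ * g, h⟩ = 1

/-- `o` is an isolated point of the space of left orders. -/
def IsIsolated (o : LO G) : Prop := IsOpen ({o} : Set (LO G))

open Classical in
/-- The numbers `ι (e 0), ι (e 1), …` for an enumeration `e` of `G`: the first one is `x₀`; a new
element which lies below (above) all the previous ones is sent one unit to the left (right) of
the leftmost (rightmost) previous number, and otherwise it is sent to the midpoint of the images
of its two neighbours among the previous elements. -/
noncomputable def iotaSeq (o : LO G) (e : ℕ ≃ G) (x₀ : ℝ) : ℕ → ℝ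
  | 0 => x₀
  | n + 1 =>
    let below : Set ℝ := {y | ∃ i : Fin (n + 1), ordLT o (e i) (e (n + 1)) ∧ y = iotaSeq o e x₀ i}
    let above : Set ℝ := {y | ∃ i : Fin (n + 1), ordLT o (e (n + 1)) (e i) ∧ y = iotaSeq o e x₀ i}
    if below = ∅ then sInf above - 1
    else if above = ∅ then sSup below + 1
    else (1 / 2) * (sSup below + sInf above)
  decreasing_by all_goals exact i.2

/-- The order preserving embedding `ι : G → ℝ` attached to a left order, an enumeration of `G`
and a real number. -/
noncomputable def iota (o : LO G) (e : ℕ ≃ G) (x₀ : ℝ) (g : G) : ℝ := iotaSeq o e x₀ (e.symm g)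

/-- The characterization of the dynamical realization: an action of `G` on `ℝ` by orientation
preserving homeomorphisms, which extends the left translation of `G` on `ι(G)` and is affine on
the closure of every gap of `Cl(ι(G))`. -/
structure IsDynamicalRealization (o : LO G) (e : ℕ ≃ G) (x₀ : ℝ) (ρ : G →* (ℝ ≃ₜ ℝ)) : Prop where
  strictMono : ∀ g, StrictMono (ρ g)
  apply_iota : ∀ g h, ρ g (iota o e x₀ h) = iota o e x₀ (g * h)
  affine_gap : ∀ (g : G) (a b : ℝ), a < b →
    closure (Set.range (iota o e x₀)) ∩ Set.Icc a b = {a, b} →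
    ∀ t ∈ Set.Icc (0 : ℝ) 1,
      ρ g (AffineMap.lineMap a b t) = AffineMap.lineMap (ρ g a) (ρ g b) t

/-! Elementary facts, which show that the dynamical realization exists and is unique. -/

section order

variable (o : LO G)

theorem lt_irrefl (f : G) : ¬ ordLT o f f := fun ⟨h, _⟩ => h (by simp)

theorem lt_mul_left (h : G) {f g : G} : ordLT o (h * f) (h * g) ↔ ordLT o f g := by
  have : (h * f)⁻¹ * (h * g) = f⁻¹ * g := by group
  simp only [ordLT, this]

theorem lt_trans {f g h : G} (h1 : ordLT o f g) (h2 : ordLT o g h) : ordLT o f h := by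
  obtain ⟨a, ha⟩ := h1
  obtain ⟨b, hb⟩ := h2
  have key := o.2.1 ⟨_, a⟩ ⟨_, b⟩ ha hb
  have : f⁻¹ * g * (g⁻¹ * h) = f⁻¹ * h := by group
  simpa only [ordLT, this] using key

theorem lt_asymm {f g : G} (h1 : ordLT o f g) : ¬ ordLT o g f :=
  fun h2 => lt_irrefl o f (lt_trans o h1 h2)

theorem lt_trichotomy (f g : G) : ordLT o f g ∨ f = g ∨ ordLT o g f := by
  by_cases hfg : f = g
  · exact Or.inr (Or.inl hfg)
  have h : f⁻¹ * g ≠ 1 := fun h => hfg (inv_mul_eq_one.1 h)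
  rcases Int.units_eq_one_or (o.1 ⟨_, h⟩) with h1 | h1
  · exact Or.inl ⟨h, h1⟩
  · refine Or.inr (Or.inr ?_)
    have key := o.2.2 ⟨_, h⟩
    have e1 : (f⁻¹ * g)⁻¹ = g⁻¹ * f := by group
    have h2 : g⁻¹ * f ≠ 1 := by rw [← e1]; exact inv_ne_one.2 h
    refine ⟨h2, ?_⟩
    rw [h1, neg_neg] at key
    rw [← key]
    exact congrArg o.1 (Subtype.ext e1.symm)

theorem exists_lt_lt [Nontrivial G] (g : G) : (∃ h, ordLT o g h) ∧ ∃ h, ordLT o h g := by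
  obtain ⟨p, hp⟩ := exists_ne (1 : G)
  have key : ∀ q : G, ordLT o 1 q → (∃ h, ordLT o g h) ∧ ∃ h, ordLT o h g := by
    intro q hq
    refine ⟨⟨g * q, ?_⟩, ⟨g * q⁻¹, ?_⟩⟩
    · have := (lt_mul_left o g).2 hq
      rwa [mul_one] at this
    · have := (lt_mul_left o (g * q⁻¹)).2 hq
      rwa [mul_one, inv_mul_cancel_right] at this
  rcases lt_trichotomy o 1 p with h | h | h
  · exact key p h
  · exact absurd h.symm hp
  · refine key p⁻¹ ?_
    have := (lt_mul_left o p⁻¹).2 h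
    rwa [mul_one, inv_mul_cancel] at this

end order

section embedding

variable (o : LO G) (e : ℕ ≃ G) (x₀ : ℝ)

theorem iotaSeq_lt (n : ℕ) : ∀ i ≤ n, ∀ j ≤ n, ordLT o (e i) (e j) →
    iotaSeq o e x₀ i < iotaSeq o e x₀ j := by
  induction n with
  | zero =>
    intro i hi j hj h
    obtain rfl : i = 0 := by omega
    obtain rfl : j = 0 := by omega
    exact absurd h (lt_irrefl o _)
  | succ n ih =>
    set B : Set ℝ := {y | ∃ i : Fin (n + 1), ordLT o (e i) (e (n + 1)) ∧ y = iotaSeq o e x₀ i} with hB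
    set A : Set ℝ := {y | ∃ i : Fin (n + 1), ordLT o (e (n + 1)) (e i) ∧ y = iotaSeq o e x₀ i} with hA
    have hBf : B.Finite := (Set.finite_range fun i : Fin (n + 1) => iotaSeq o e x₀ i).subset (by
      rintro y ⟨i, -, rfl⟩; exact ⟨i, rfl⟩)
    have hAf : A.Finite := (Set.finite_range fun i : Fin (n + 1) => iotaSeq o e x₀ i).subset (by
      rintro y ⟨i, -, rfl⟩; exact ⟨i, rfl⟩)
    have hBA : ∀ b ∈ B, ∀ a ∈ A, b < a := by
      rintro _ ⟨i, hi, rfl⟩ _ ⟨j, hj, rfl⟩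
      exact ih i (by omega) j (by omega) (lt_trans o hi hj)
    have hval : (∀ b ∈ B, b < iotaSeq o e x₀ (n + 1)) ∧
        (∀ a ∈ A, iotaSeq o e x₀ (n + 1) < a) := by
      rw [iotaSeq]
      simp only [← hB, ← hA]
      split_ifs with h1 h2
      · refine ⟨by simp [h1], fun a ha => ?_⟩
        have := csInf_le hAf.bddBelow ha
        linarith
      · refine ⟨fun b hb => ?_, by simp [h2]⟩
        have := le_csSup hBf.bddAbove hb
        linarith
      · have hm := hBA _ ((Set.nonempty_iff_ne_empty.2 h1).csSup_mem hBf) _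
          ((Set.nonempty_iff_ne_empty.2 h2).csInf_mem hAf)
        refine ⟨fun b hb => ?_, fun a ha => ?_⟩
        · have := le_csSup hBf.bddAbove hb
          linarith
        · have := csInf_le hAf.bddBelow ha
          linarith
    intro i hi j hj h
    rcases Nat.lt_or_ge i (n + 1) with hi2 | hi2
    · rcases Nat.lt_or_ge j (n + 1) with hj2 | hj2
      · exact ih i (by omega) j (by omega) h
      · obtain rfl : j = n + 1 := by omega
        exact hval.1 _ ⟨⟨i, hi2⟩, h, rfl⟩
    · obtain rfl : i = n + 1 := by omega
      rcases Nat.lt_or_ge j (n + 1) with hj2 | hj2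
      · exact hval.2 _ ⟨⟨j, hj2⟩, h, rfl⟩
      · obtain rfl : j = n + 1 := by omega
        exact absurd h (lt_irrefl o _)

theorem iotaSeq_lt_iff (i j : ℕ) : iotaSeq o e x₀ i < iotaSeq o e x₀ j ↔ ordLT o (e i) (e j) := by
  have key : ∀ i j, ordLT o (e i) (e j) → iotaSeq o e x₀ i < iotaSeq o e x₀ j := fun i j h =>
    iotaSeq_lt o e x₀ (max i j) i (le_max_left _ _) j (le_max_right _ _) h
  refine ⟨fun h => ?_, key i j⟩
  rcases lt_trichotomy o (e i) (e j) with h1 | h1 | h1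
  · exact h1
  · rw [e.injective h1] at h
    exact absurd h (_root_.lt_irrefl _)
  · exact absurd h (_root_.lt_asymm (key j i h1))

theorem iota_lt_iff (f g : G) : iota o e x₀ f < iota o e x₀ g ↔ ordLT o f g := by
  simp [iota, iotaSeq_lt_iff]

theorem iota_le_iff (f g : G) : iota o e x₀ f ≤ iota o e x₀ g ↔ ¬ ordLT o g f := by
  rw [← not_lt, iota_lt_iff]

/-- The midpoint rule, for an element whose neighbours among the previous ones are known. -/
theorem iotaSeq_mid (i j m : ℕ) (hi : i < m) (hj : j < m)
    (him : iotaSeq o e x₀ i < iotaSeq o e x₀ m) (hjm : iotaSeq o e x₀ m < iotaSeq o e x₀ j)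
    (hk : ∀ k < m, iotaSeq o e x₀ k ≤ iotaSeq o e x₀ i ∨ iotaSeq o e x₀ j ≤ iotaSeq o e x₀ k) :
    iotaSeq o e x₀ m = (1 / 2) * (iotaSeq o e x₀ i + iotaSeq o e x₀ j) := by
  obtain ⟨n, rfl⟩ : ∃ n, m = n + 1 := ⟨m - 1, by omega⟩
  set B : Set ℝ := {y | ∃ i : Fin (n + 1), ordLT o (e i) (e (n + 1)) ∧ y = iotaSeq o e x₀ i} with hB
  set A : Set ℝ := {y | ∃ i : Fin (n + 1), ordLT o (e (n + 1)) (e i) ∧ y = iotaSeq o e x₀ i} with hA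
  have hiB : iotaSeq o e x₀ i ∈ B := ⟨⟨i, hi⟩, (iotaSeq_lt_iff o e x₀ _ _).1 him, rfl⟩
  have hjA : iotaSeq o e x₀ j ∈ A := ⟨⟨j, hj⟩, (iotaSeq_lt_iff o e x₀ _ _).1 hjm, rfl⟩
  have hBs : IsGreatest B (iotaSeq o e x₀ i) := by
    refine ⟨hiB, ?_⟩
    rintro _ ⟨k, hk1, rfl⟩
    have := (iotaSeq_lt_iff o e x₀ _ _).2 hk1
    rcases hk k k.2 with h | h
    · exact h
    · linarith
  have hAs : IsLeast A (iotaSeq o e x₀ j) := by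
    refine ⟨hjA, ?_⟩
    rintro _ ⟨k, hk1, rfl⟩
    have := (iotaSeq_lt_iff o e x₀ _ _).2 hk1
    rcases hk k k.2 with h | h
    · linarith
    · exact h
  rw [iotaSeq]
  simp only [← hB, ← hA]
  rw [if_neg (Set.nonempty_iff_ne_empty.1 ⟨_, hiB⟩), if_neg (Set.nonempty_iff_ne_empty.1 ⟨_, hjA⟩),
    hBs.csSup_eq, hAs.csInf_eq]

theorem iotaSeq_top (i m : ℕ) (hi : i < m) (him : iotaSeq o e x₀ i < iotaSeq o e x₀ m)
    (hk : ∀ k < m, iotaSeq o e x₀ k ≤ iotaSeq o e x₀ i) :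
    iotaSeq o e x₀ m = iotaSeq o e x₀ i + 1 := by
  obtain ⟨n, rfl⟩ : ∃ n, m = n + 1 := ⟨m - 1, by omega⟩
  set B : Set ℝ := {y | ∃ i : Fin (n + 1), ordLT o (e i) (e (n + 1)) ∧ y = iotaSeq o e x₀ i} with hB
  set A : Set ℝ := {y | ∃ i : Fin (n + 1), ordLT o (e (n + 1)) (e i) ∧ y = iotaSeq o e x₀ i} with hA
  have hiB : iotaSeq o e x₀ i ∈ B := ⟨⟨i, hi⟩, (iotaSeq_lt_iff o e x₀ _ _).1 him, rfl⟩
  have hBs : IsGreatest B (iotaSeq o e x₀ i) := by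
    refine ⟨hiB, ?_⟩
    rintro _ ⟨k, -, rfl⟩
    exact hk k k.2
  have hAe : A = ∅ := by
    refine Set.eq_empty_iff_forall_notMem.2 ?_
    rintro _ ⟨k, hk1, rfl⟩
    have := (iotaSeq_lt_iff o e x₀ _ _).2 hk1
    have := hk k k.2
    linarith
  rw [iotaSeq]
  simp only [← hB, ← hA]
  rw [if_neg (Set.nonempty_iff_ne_empty.1 ⟨_, hiB⟩), if_pos hAe, hBs.csSup_eq]

theorem iotaSeq_bot (i m : ℕ) (hi : i < m) (him : iotaSeq o e x₀ m < iotaSeq o e x₀ i)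
    (hk : ∀ k < m, iotaSeq o e x₀ i ≤ iotaSeq o e x₀ k) :
    iotaSeq o e x₀ m = iotaSeq o e x₀ i - 1 := by
  obtain ⟨n, rfl⟩ : ∃ n, m = n + 1 := ⟨m - 1, by omega⟩
  set B : Set ℝ := {y | ∃ i : Fin (n + 1), ordLT o (e i) (e (n + 1)) ∧ y = iotaSeq o e x₀ i} with hB
  set A : Set ℝ := {y | ∃ i : Fin (n + 1), ordLT o (e (n + 1)) (e i) ∧ y = iotaSeq o e x₀ i} with hA
  have hiA : iotaSeq o e x₀ i ∈ A := ⟨⟨i, hi⟩, (iotaSeq_lt_iff o e x₀ _ _).1 him, rfl⟩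
  have hAs : IsLeast A (iotaSeq o e x₀ i) := by
    refine ⟨hiA, ?_⟩
    rintro _ ⟨k, -, rfl⟩
    exact hk k k.2
  have hBe : B = ∅ := by
    refine Set.eq_empty_iff_forall_notMem.2 ?_
    rintro _ ⟨k, hk1, rfl⟩
    have := (iotaSeq_lt_iff o e x₀ _ _).2 hk1
    have := hk k k.2
    linarith
  rw [iotaSeq]
  simp only [← hB, ← hA]
  rw [if_pos hBe, hAs.csInf_eq]

theorem exists_iota_gt (x : ℝ) : ∃ g, x < iota o e x₀ g := by
  classical
  have : Nontrivial G := e.symm.nontrivial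
  by_contra hx
  push Not at hx
  have hbdd : BddAbove (Set.range (iotaSeq o e x₀)) :=
    ⟨x, by rintro _ ⟨n, rfl⟩; simpa [iota] using hx (e n)⟩
  set S := sSup (Set.range (iotaSeq o e x₀)) with hS
  have hle : ∀ n, iotaSeq o e x₀ n ≤ S := fun n => le_csSup hbdd ⟨n, rfl⟩
  have hex : ∃ n, S - 1 / 2 < iotaSeq o e x₀ n := by
    obtain ⟨_, ⟨n, rfl⟩, hn⟩ := exists_lt_of_lt_csSup (Set.range_nonempty (iotaSeq o e x₀))
      (show S - 1 / 2 < sSup (Set.range (iotaSeq o e x₀)) by linarith)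
    exact ⟨n, hn⟩
  have hm := Nat.find_spec hex
  have hmin : ∀ k < Nat.find hex, iotaSeq o e x₀ k < iotaSeq o e x₀ (Nat.find hex) := by
    intro k hk
    have := Nat.find_min hex hk
    linarith
  set m := Nat.find hex
  have hex2 : ∃ n, iotaSeq o e x₀ m < iotaSeq o e x₀ n := by
    obtain ⟨g, hg⟩ := (exists_lt_lt o (e m)).1
    exact ⟨e.symm g, (iotaSeq_lt_iff o e x₀ _ _).2 (by simpa using hg)⟩
  have hm2 := Nat.find_spec hex2
  have hmin2 : ∀ k < Nat.find hex2, iotaSeq o e x₀ k ≤ iotaSeq o e x₀ m := fun k hk =>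
    not_lt.1 (Nat.find_min hex2 hk)
  set m2 := Nat.find hex2
  have hlt : m < m2 := by
    rcases Nat.lt_trichotomy m m2 with h | h | h
    · exact h
    · rw [← h] at hm2
      exact absurd hm2 (_root_.lt_irrefl _)
    · exact absurd hm2 (_root_.lt_asymm (hmin _ h))
  have := iotaSeq_top o e x₀ m m2 hlt hm2 hmin2
  have := hle m2
  linarith

theorem exists_iota_lt (x : ℝ) : ∃ g, iota o e x₀ g < x := by
  classical
  have : Nontrivial G := e.symm.nontrivial
  by_contra hx
  push Not at hx
  have hbdd : BddBelow (Set.range (iotaSeq o e x₀)) :=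
    ⟨x, by rintro _ ⟨n, rfl⟩; simpa [iota] using hx (e n)⟩
  set S := sInf (Set.range (iotaSeq o e x₀)) with hS
  have hle : ∀ n, S ≤ iotaSeq o e x₀ n := fun n => csInf_le hbdd ⟨n, rfl⟩
  have hex : ∃ n, iotaSeq o e x₀ n < S + 1 / 2 := by
    obtain ⟨_, ⟨n, rfl⟩, hn⟩ := exists_lt_of_csInf_lt (Set.range_nonempty (iotaSeq o e x₀))
      (show sInf (Set.range (iotaSeq o e x₀)) < S + 1 / 2 by linarith)
    exact ⟨n, hn⟩
  have hm := Nat.find_spec hex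
  have hmin : ∀ k < Nat.find hex, iotaSeq o e x₀ (Nat.find hex) < iotaSeq o e x₀ k := by
    intro k hk
    have := Nat.find_min hex hk
    linarith
  set m := Nat.find hex
  have hex2 : ∃ n, iotaSeq o e x₀ n < iotaSeq o e x₀ m := by
    obtain ⟨g, hg⟩ := (exists_lt_lt o (e m)).2
    exact ⟨e.symm g, (iotaSeq_lt_iff o e x₀ _ _).2 (by simpa using hg)⟩
  have hm2 := Nat.find_spec hex2
  have hmin2 : ∀ k < Nat.find hex2, iotaSeq o e x₀ m ≤ iotaSeq o e x₀ k := fun k hk =>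
    not_lt.1 (Nat.find_min hex2 hk)
  set m2 := Nat.find hex2
  have hlt : m < m2 := by
    rcases Nat.lt_trichotomy m m2 with h | h | h
    · exact h
    · rw [← h] at hm2
      exact absurd hm2 (_root_.lt_irrefl _)
    · exact absurd hm2 (_root_.lt_asymm (hmin _ h))
  have := iotaSeq_bot o e x₀ m m2 hlt hm2 hmin2
  have := hle m2
  linarith

/-- `f < g` are adjacent for the left order `o`. -/
def Adj (o : LO G) (f g : G) : Prop := ordLT o f g ∧ ∀ k, ¬ (ordLT o f k ∧ ordLT o k g)

theorem Adj.mul_left {o : LO G} {f g : G} (h : Adj o f g) (k : G) : Adj o (k * f) (k * g) := by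
  refine ⟨(lt_mul_left o k).2 h.1, fun l ⟨h1, h2⟩ => h.2 (k⁻¹ * l) ⟨?_, ?_⟩⟩
  · rw [← lt_mul_left o k]; simpa using h1
  · rw [← lt_mul_left o k]; simpa using h2

/-- An interval without points of `ι(G)` lies in an interval between the images of two adjacent
elements. -/
theorem exists_adj {u v : ℝ} (huv : u < v) (hno : ∀ k, iota o e x₀ k ≤ u ∨ v ≤ iota o e x₀ k) :
    ∃ f g, Adj o f g ∧ iota o e x₀ f ≤ u ∧ v ≤ iota o e x₀ g := by
  classical
  set s := iotaSeq o e x₀ with hs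
  have hno2 : ∀ n, s n ≤ u ∨ v ≤ s n := fun n => by simpa [iota] using hno (e n)
  set L : Set ℝ := {y | ∃ n, s n = y ∧ y ≤ u} with hL
  set R : Set ℝ := {y | ∃ n, s n = y ∧ v ≤ y} with hR
  have hLne : L.Nonempty := by
    obtain ⟨g, hg⟩ := exists_iota_lt o e x₀ u
    exact ⟨_, e.symm g, rfl, hg.le⟩
  have hRne : R.Nonempty := by
    obtain ⟨g, hg⟩ := exists_iota_gt o e x₀ v
    exact ⟨_, e.symm g, rfl, hg.le⟩
  have hLb : BddAbove L := ⟨u, by rintro _ ⟨n, rfl, h⟩; exact h⟩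
  have hRb : BddBelow R := ⟨v, by rintro _ ⟨n, rfl, h⟩; exact h⟩
  set a := sSup L with ha
  set b := sInf R with hb
  have hau : a ≤ u := csSup_le hLne (by rintro _ ⟨n, rfl, h⟩; exact h)
  have hvb : v ≤ b := le_csInf hRne (by rintro _ ⟨n, rfl, h⟩; exact h)
  have hd : 0 < (b - a) / 4 := by linarith
  obtain ⟨_, ⟨n1, rfl, hn1⟩, hn1a⟩ := exists_lt_of_lt_csSup hLne
    (show a - (b - a) / 4 < sSup L by linarith)
  obtain ⟨_, ⟨n2, rfl, hn2⟩, hn2b⟩ := exists_lt_of_csInf_lt hRne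
    (show sInf R < b + (b - a) / 4 by linarith)
  set N := max n1 n2 with hN
  obtain ⟨p, hpm, hpmax⟩ := Finset.exists_max_image
    ((Finset.range (N + 1)).filter fun n => s n ≤ u) s
    ⟨n1, by simp only [Finset.mem_filter, Finset.mem_range]; exact ⟨by omega, hn1⟩⟩
  obtain ⟨q, hqm, hqmin⟩ := Finset.exists_min_image
    ((Finset.range (N + 1)).filter fun n => v ≤ s n) s
    ⟨n2, by simp only [Finset.mem_filter, Finset.mem_range]; exact ⟨by omega, hn2⟩⟩
  simp only [Finset.mem_filter, Finset.mem_range] at hpm hqm hpmax hqmin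
  have hp1 : s n1 ≤ s p := hpmax n1 ⟨by omega, hn1⟩
  have hq1 : s q ≤ s n2 := hqmin n2 ⟨by omega, hn2⟩
  have hpa : s p ≤ a := le_csSup hLb ⟨p, rfl, hpm.2⟩
  have hqb : b ≤ s q := csInf_le hRb ⟨q, rfl, hqm.2⟩
  have hnone : ¬ ∃ m, s p < s m ∧ s m < s q := by
    intro hex
    have hm := Nat.find_spec hex
    have hmin : ∀ k < Nat.find hex, s k ≤ s p ∨ s q ≤ s k := fun k hk => by
      have := Nat.find_min hex hk
      by_contra hcon
      push Not at hcon
      exact this hcon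
    set m := Nat.find hex
    have hNm : N < m := by
      by_contra hcon
      rcases hno2 m with h | h
      · exact absurd (hpmax m ⟨by omega, h⟩) (not_le.2 hm.1)
      · exact absurd (hqmin m ⟨by omega, h⟩) (not_le.2 hm.2)
    have hmid : s m = (1 / 2) * (s p + s q) :=
      iotaSeq_mid o e x₀ p q m (by omega) (by omega) hm.1 hm.2 hmin
    rcases hno2 m with h | h
    · have := le_csSup hLb ⟨m, rfl, h⟩
      linarith
    · have := csInf_le hRb ⟨m, rfl, h⟩
      linarith
  refine ⟨e p, e q, ⟨(iotaSeq_lt_iff o e x₀ _ _).1 ?_, ?_⟩, ?_, ?_⟩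
  · show s p < s q
    linarith
  · rintro k ⟨h1, h2⟩
    refine hnone ⟨e.symm k, (iotaSeq_lt_iff o e x₀ _ _).2 ?_, (iotaSeq_lt_iff o e x₀ _ _).2 ?_⟩
    · simpa using h1
    · simpa using h2
  · simpa [iota] using hpm.2
  · simpa [iota] using hqm.2

theorem Adj.iota_le_or {o : LO G} {f g : G} (h : Adj o f g) (k : G) :
    iota o e x₀ k ≤ iota o e x₀ f ∨ iota o e x₀ g ≤ iota o e x₀ k := by
  by_contra hcon
  push Not at hcon
  exact h.2 k ⟨(iota_lt_iff o e x₀ _ _).1 hcon.1, (iota_lt_iff o e x₀ _ _).1 hcon.2⟩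

/-- The gaps of `Cl(ι(G))` are the intervals between the images of adjacent elements. -/
theorem gap_iff {a b : ℝ} (hab : a < b) :
    closure (Set.range (iota o e x₀)) ∩ Set.Icc a b = {a, b} ↔
      ∃ f g, Adj o f g ∧ iota o e x₀ f = a ∧ iota o e x₀ g = b := by
  have hopen : ∀ f g, Adj o f g → ∀ y ∈ closure (Set.range (iota o e x₀)),
      y ≤ iota o e x₀ f ∨ iota o e x₀ g ≤ y := by
    intro f g hfg y hy
    by_contra hcon
    push Not at hcon
    obtain ⟨_, hz, ⟨k, rfl⟩⟩ := mem_closure_iff.1 hy (Set.Ioo (iota o e x₀ f) (iota o e x₀ g))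
      isOpen_Ioo hcon
    rcases hfg.iota_le_or e x₀ k with h | h
    · exact absurd hz.1 (not_lt.2 h)
    · exact absurd hz.2 (not_lt.2 h)
  constructor
  · intro h
    have hno : ∀ k, iota o e x₀ k ≤ a ∨ b ≤ iota o e x₀ k := by
      intro k
      by_contra hcon
      push Not at hcon
      have : iota o e x₀ k ∈ ({a, b} : Set ℝ) := by
        rw [← h]
        exact ⟨subset_closure ⟨k, rfl⟩, hcon.1.le, hcon.2.le⟩
      rcases this with h1 | h1
      · linarith [hcon.1]
      · rw [Set.mem_singleton_iff] at h1
        linarith [hcon.2]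
    obtain ⟨f, g, hfg, hf, hg⟩ := exists_adj o e x₀ hab hno
    have haC : a ∈ closure (Set.range (iota o e x₀)) := by
      have : a ∈ ({a, b} : Set ℝ) := by simp
      rw [← h] at this
      exact this.1
    have hbC : b ∈ closure (Set.range (iota o e x₀)) := by
      have : b ∈ ({a, b} : Set ℝ) := by simp
      rw [← h] at this
      exact this.1
    refine ⟨f, g, hfg, le_antisymm hf ?_, le_antisymm ?_ hg⟩
    · rcases hopen f g hfg a haC with h1 | h1
      · exact h1
      · linarith
    · rcases hopen f g hfg b hbC with h1 | h1
      · linarith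
      · exact h1
  · rintro ⟨f, g, hfg, rfl, rfl⟩
    ext y
    constructor
    · rintro ⟨hy, h1, h2⟩
      rcases hopen f g hfg y hy with h | h
      · exact Or.inl (le_antisymm h h1)
      · exact Or.inr (le_antisymm h2 h)
    · rintro (rfl | rfl)
      · exact ⟨subset_closure ⟨f, rfl⟩, le_rfl, hab.le⟩
      · exact ⟨subset_closure ⟨g, rfl⟩, hab.le, le_rfl⟩

end embedding

section realization

variable (o : LO G) (e : ℕ ≃ G) (x₀ : ℝ)

/-- Monotone maps which extend the left translation by `g` and are affine on the gaps. -/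
structure IsExtension (g : G) (F : ℝ → ℝ) : Prop where
  mono : Monotone F
  apply_iota : ∀ h, F (iota o e x₀ h) = iota o e x₀ (g * h)
  affine : ∀ f k, Adj o f k → ∀ t ∈ Set.Icc (0 : ℝ) 1,
    F (AffineMap.lineMap (iota o e x₀ f) (iota o e x₀ k) t) =
      AffineMap.lineMap (iota o e x₀ (g * f)) (iota o e x₀ (g * k)) t

theorem exists_lineMap {a b x : ℝ} (ha : a ≤ x) (hb : x ≤ b) (hab : a < b) :
    ∃ t ∈ Set.Icc (0 : ℝ) 1, AffineMap.lineMap a b t = x := by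
  have hpos : 0 < b - a := sub_pos.2 hab
  refine ⟨(x - a) / (b - a), ⟨div_nonneg (by linarith) hpos.le,
    (div_le_one hpos).2 (by linarith)⟩, ?_⟩
  rw [AffineMap.lineMap_apply_ring']
  field_simp
  ring

variable {o e x₀}

theorem IsExtension.le_of_le {g : G} {F F' : ℝ → ℝ} (hF : IsExtension o e x₀ g F)
    (hF' : IsExtension o e x₀ g F') (x : ℝ) : F' x ≤ F x := by
  by_contra hlt
  push Not at hlt
  have hno : ∀ k, iota o e x₀ k ≤ F x ∨ F' x ≤ iota o e x₀ k := by
    intro k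
    have hk : g * (g⁻¹ * k) = k := by group
    rcases le_total (iota o e x₀ (g⁻¹ * k)) x with h | h
    · left
      have := hF.mono h
      rwa [hF.apply_iota, hk] at this
    · right
      have := hF'.mono h
      rwa [hF'.apply_iota, hk] at this
  obtain ⟨f, k, hfk, hf, hk⟩ := exists_adj o e x₀ hlt hno
  have hadj := hfk.mul_left g⁻¹
  have e1 : g * (g⁻¹ * f) = f := by group
  have e2 : g * (g⁻¹ * k) = k := by group
  have h1 : iota o e x₀ (g⁻¹ * f) ≤ x := by
    by_contra hcon
    have := hF'.mono (not_le.1 hcon).le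
    rw [hF'.apply_iota, e1] at this
    linarith
  have h2 : x ≤ iota o e x₀ (g⁻¹ * k) := by
    by_contra hcon
    have := hF.mono (not_le.1 hcon).le
    rw [hF.apply_iota, e2] at this
    linarith
  obtain ⟨t, ht, rfl⟩ := exists_lineMap h1 h2 ((iota_lt_iff o e x₀ _ _).2 hadj.1)
  rw [hF.affine _ _ hadj t ht, hF'.affine _ _ hadj t ht] at hlt
  exact _root_.lt_irrefl _ hlt

theorem IsExtension.unique {g : G} {F F' : ℝ → ℝ} (hF : IsExtension o e x₀ g F)
    (hF' : IsExtension o e x₀ g F') : F = F' :=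
  funext fun x => le_antisymm (hF'.le_of_le hF x) (hF.le_of_le hF' x)

theorem IsExtension.comp {g h : G} {F F' : ℝ → ℝ} (hF : IsExtension o e x₀ g F)
    (hF' : IsExtension o e x₀ h F') : IsExtension o e x₀ (g * h) (F ∘ F') where
  mono := hF.mono.comp hF'.mono
  apply_iota k := by simp [hF'.apply_iota, hF.apply_iota, mul_assoc]
  affine f k hfk t ht := by
    rw [Function.comp_apply, hF'.affine f k hfk t ht, hF.affine _ _ (hfk.mul_left h) t ht,
      mul_assoc, mul_assoc]

theorem isExtension_id : IsExtension o e x₀ 1 id where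
  mono := monotone_id
  apply_iota k := by simp
  affine f k _ t _ := by simp

variable (o e x₀)

open Classical in
/-- The extension of the left translation by `g` to the real line. -/
noncomputable def extend (g : G) (x : ℝ) : ℝ :=
  if h : ∃ p : G × G, Adj o p.1 p.2 ∧ iota o e x₀ p.1 ≤ x ∧ x < iota o e x₀ p.2 then
    AffineMap.lineMap (iota o e x₀ (g * h.choose.1)) (iota o e x₀ (g * h.choose.2))
      ((x - iota o e x₀ h.choose.1) / (iota o e x₀ h.choose.2 - iota o e x₀ h.choose.1))
  else sSup {y | ∃ k, iota o e x₀ k ≤ x ∧ y = iota o e x₀ (g * k)}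

theorem iota_injective : Function.Injective (iota o e x₀) := by
  intro f g h
  rcases lt_trichotomy o f g with h1 | h1 | h1
  · exact absurd h ((iota_lt_iff o e x₀ _ _).2 h1).ne
  · exact h1
  · exact absurd h ((iota_lt_iff o e x₀ _ _).2 h1).ne'

theorem iota_mul_le_iff (g f k : G) :
    iota o e x₀ (g * f) ≤ iota o e x₀ (g * k) ↔ iota o e x₀ f ≤ iota o e x₀ k := by
  rw [iota_le_iff, iota_le_iff, lt_mul_left]

theorem extend_of_adj (g f k : G) (hfk : Adj o f k) (x : ℝ) (h1 : iota o e x₀ f ≤ x)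
    (h2 : x < iota o e x₀ k) :
    extend o e x₀ g x = AffineMap.lineMap (iota o e x₀ (g * f)) (iota o e x₀ (g * k))
      ((x - iota o e x₀ f) / (iota o e x₀ k - iota o e x₀ f)) := by
  have h : ∃ p : G × G, Adj o p.1 p.2 ∧ iota o e x₀ p.1 ≤ x ∧ x < iota o e x₀ p.2 :=
    ⟨(f, k), hfk, h1, h2⟩
  obtain ⟨c1, c2, c3⟩ := h.choose_spec
  have e1 : h.choose.1 = f := by
    apply iota_injective o e x₀
    apply le_antisymm
    · rcases hfk.iota_le_or e x₀ h.choose.1 with h' | h'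
      · exact h'
      · linarith
    · rcases c1.iota_le_or e x₀ f with h' | h'
      · exact h'
      · linarith
  have e2 : h.choose.2 = k := by
    apply iota_injective o e x₀
    apply le_antisymm
    · rcases c1.iota_le_or e x₀ k with h' | h'
      · linarith
      · exact h'
    · rcases hfk.iota_le_or e x₀ h.choose.2 with h' | h'
      · linarith
      · exact h'
  rw [extend, dif_pos h, e1, e2]

theorem extend_iota (g h : G) : extend o e x₀ g (iota o e x₀ h) = iota o e x₀ (g * h) := by
  by_cases hex : ∃ k, Adj o h k
  · obtain ⟨k, hk⟩ := hex
    rw [extend_of_adj o e x₀ g h k hk _ le_rfl ((iota_lt_iff o e x₀ _ _).2 hk.1)]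
    simp
  · have hne : ¬ ∃ p : G × G, Adj o p.1 p.2 ∧ iota o e x₀ p.1 ≤ iota o e x₀ h ∧
        iota o e x₀ h < iota o e x₀ p.2 := by
      rintro ⟨⟨f, k⟩, hfk, h1, h2⟩
      refine hex ⟨k, ?_⟩
      rcases hfk.iota_le_or e x₀ h with h' | h'
      · rw [← iota_injective o e x₀ (le_antisymm h1 h')]
        exact hfk
      · exact absurd h2 (not_lt.2 h')
    rw [extend, dif_neg hne]
    refine IsGreatest.csSup_eq ⟨⟨h, le_rfl, rfl⟩, ?_⟩
    rintro _ ⟨k, hk, rfl⟩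
    exact (iota_mul_le_iff o e x₀ g k h).2 hk

theorem extend_bounds (g h : G) (x : ℝ) :
    (iota o e x₀ h ≤ x → iota o e x₀ (g * h) ≤ extend o e x₀ g x) ∧
    (x ≤ iota o e x₀ h → extend o e x₀ g x ≤ iota o e x₀ (g * h)) := by
  by_cases hex : ∃ p : G × G, Adj o p.1 p.2 ∧ iota o e x₀ p.1 ≤ x ∧ x < iota o e x₀ p.2
  · obtain ⟨⟨f, k⟩, hfk, h1, h2⟩ := hex
    simp only at hfk h1 h2
    rw [extend_of_adj o e x₀ g f k hfk x h1 h2]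
    have hd : 0 < iota o e x₀ k - iota o e x₀ f := by linarith
    have hgd : 0 < iota o e x₀ (g * k) - iota o e x₀ (g * f) :=
      sub_pos.2 ((iota_lt_iff o e x₀ _ _).2 (hfk.mul_left g).1)
    have ht0 : 0 ≤ (x - iota o e x₀ f) / (iota o e x₀ k - iota o e x₀ f) :=
      div_nonneg (by linarith) hd.le
    have ht1 : (x - iota o e x₀ f) / (iota o e x₀ k - iota o e x₀ f) ≤ 1 :=
      (div_le_one hd).2 (by linarith)
    rw [AffineMap.lineMap_apply_ring']
    constructor
    · intro hh
      have hle : iota o e x₀ h ≤ iota o e x₀ f := by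
        rcases hfk.iota_le_or e x₀ h with h' | h'
        · exact h'
        · linarith
      have := (iota_mul_le_iff o e x₀ g h f).2 hle
      nlinarith [mul_nonneg ht0 hgd.le]
    · intro hh
      rcases hfk.iota_le_or e x₀ h with h' | h'
      · have hx : x = iota o e x₀ f := by linarith
        have hf : iota o e x₀ h = iota o e x₀ f := by linarith
        rw [iota_injective o e x₀ hf, hx]
        simp
      · have := (iota_mul_le_iff o e x₀ g k h).2 h'
        nlinarith [mul_le_mul_of_nonneg_right ht1 hgd.le]
  · rw [extend, dif_neg hex]
    obtain ⟨l, hl⟩ := exists_iota_lt o e x₀ x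
    obtain ⟨r, hr⟩ := exists_iota_gt o e x₀ x
    constructor
    · intro hh
      refine le_csSup ⟨iota o e x₀ (g * r), ?_⟩ ⟨h, hh, rfl⟩
      rintro _ ⟨k, hk, rfl⟩
      exact (iota_mul_le_iff o e x₀ g k r).2 (by linarith)
    · intro hh
      refine csSup_le ⟨_, l, hl.le, rfl⟩ ?_
      rintro _ ⟨k, hk, rfl⟩
      exact (iota_mul_le_iff o e x₀ g k h).2 (by linarith)

theorem isExtension_extend (g : G) : IsExtension o e x₀ g (extend o e x₀ g) where
  mono := by
    intro x y hxy
    rcases hxy.eq_or_lt with rfl | hlt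
    · exact le_rfl
    by_cases hex : ∃ k, x ≤ iota o e x₀ k ∧ iota o e x₀ k ≤ y
    · obtain ⟨k, h1, h2⟩ := hex
      exact ((extend_bounds o e x₀ g k x).2 h1).trans ((extend_bounds o e x₀ g k y).1 h2)
    · push Not at hex
      have hno : ∀ k, iota o e x₀ k ≤ x ∨ y ≤ iota o e x₀ k := by
        intro k
        rcases le_total (iota o e x₀ k) x with h | h
        · exact Or.inl h
        · exact Or.inr (hex k h).le
      obtain ⟨f, k, hfk, hf, hk⟩ := exists_adj o e x₀ hlt hno
      have hk2 : y < iota o e x₀ k := hex k (by linarith)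
      rw [extend_of_adj o e x₀ g f k hfk x hf (by linarith),
        extend_of_adj o e x₀ g f k hfk y (by linarith) hk2, AffineMap.lineMap_apply_ring',
        AffineMap.lineMap_apply_ring']
      have hd : 0 < iota o e x₀ k - iota o e x₀ f := by linarith
      have hgd : 0 < iota o e x₀ (g * k) - iota o e x₀ (g * f) :=
        sub_pos.2 ((iota_lt_iff o e x₀ _ _).2 (hfk.mul_left g).1)
      gcongr
  apply_iota := extend_iota o e x₀ g
  affine := by
    intro f k hfk t ht
    have hd : 0 < iota o e x₀ k - iota o e x₀ f :=
      sub_pos.2 ((iota_lt_iff o e x₀ _ _).2 hfk.1)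
    rcases ht.2.eq_or_lt with rfl | ht1
    · simp [extend_iota]
    · rw [extend_of_adj o e x₀ g f k hfk]
      · congr 1
        rw [AffineMap.lineMap_apply_ring']
        field_simp
        ring
      · rw [AffineMap.lineMap_apply_ring']
        nlinarith [mul_nonneg ht.1 hd.le]
      · rw [AffineMap.lineMap_apply_ring']
        nlinarith [mul_lt_mul_of_pos_right ht1 hd]

theorem extend_mul (g h : G) (x : ℝ) :
    extend o e x₀ g (extend o e x₀ h x) = extend o e x₀ (g * h) x :=
  congrFun (((isExtension_extend o e x₀ g).comp (isExtension_extend o e x₀ h)).unique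
    (isExtension_extend o e x₀ (g * h))) x

theorem extend_one (x : ℝ) : extend o e x₀ 1 x = x :=
  congrFun ((isExtension_extend o e x₀ 1).unique isExtension_id) x

theorem extend_strictMono (g : G) : StrictMono (extend o e x₀ g) := by
  refine (isExtension_extend o e x₀ g).mono.strictMono_of_injective ?_
  intro x y h
  have := congrArg (extend o e x₀ g⁻¹) h
  simpa [extend_mul, extend_one] using this

/-- The extended action, as a homomorphism to the homeomorphism group of the line. -/
noncomputable def extendHom : G →* (ℝ ≃ₜ ℝ) where
  toFun g := ((extend_strictMono o e x₀ g).orderIsoOfSurjective _ (fun x =>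
    ⟨extend o e x₀ g⁻¹ x, by simp [extend_mul, extend_one]⟩)).toHomeomorph
  map_one' := by
    ext x
    exact extend_one o e x₀ x
  map_mul' g h := by
    ext x
    exact (extend_mul o e x₀ g h x).symm

theorem extendHom_apply (g : G) (x : ℝ) : extendHom o e x₀ g x = extend o e x₀ g x := rfl

theorem existsUnique_isDynamicalRealization :
    ∃! ρ : G →* (ℝ ≃ₜ ℝ), IsDynamicalRealization o e x₀ ρ := by
  refine ⟨extendHom o e x₀, ⟨fun g => ?_, fun g h => ?_, ?_⟩, ?_⟩
  · exact extend_strictMono o e x₀ g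
  · exact extend_iota o e x₀ g h
  · intro g a b hab hgap t ht
    obtain ⟨f, k, hfk, rfl, rfl⟩ := (gap_iff o e x₀ hab).1 hgap
    simp only [extendHom_apply]
    rw [(isExtension_extend o e x₀ g).affine f k hfk t ht, extend_iota, extend_iota]
  · intro ρ hρ
    refine MonoidHom.ext fun g => Homeomorph.ext fun x => ?_
    have hext : IsExtension o e x₀ g (ρ g) := by
      refine ⟨(hρ.strictMono g).monotone, hρ.apply_iota g, fun f k hfk t ht => ?_⟩
      have hlt := (iota_lt_iff o e x₀ _ _).2 hfk.1
      rw [hρ.affine_gap g _ _ hlt ((gap_iff o e x₀ hlt).2 ⟨f, k, hfk, rfl, rfl⟩) t ht,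
        hρ.apply_iota, hρ.apply_iota]
    exact congrFun (hext.unique (isExtension_extend o e x₀ g)) x

end realization

/-- The dynamical realization of the left order `o` based at `x₀`, defined via the enumeration
`e` of `G`. -/
noncomputable def dynamicalRealization (o : LO G) (e : ℕ ≃ G) (x₀ : ℝ) : G →* (ℝ ≃ₜ ℝ) :=
  (existsUnique_isDynamicalRealization o e x₀).choose

theorem dynamicalRealization_spec (o : LO G) (e : ℕ ≃ G) (x₀ : ℝ) :
    IsDynamicalRealization o e x₀ (dynamicalRealization o e x₀) :=
  (existsUnique_isDynamicalRealization o e x₀).choose_spec.1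

/-- An action on the real line is minimal if all its orbits are dense. -/
def IsMinimalAction (ρ : G →* (ℝ ≃ₜ ℝ)) : Prop :=
  ∀ x : ℝ, Dense (Set.range fun g => ρ g x)

end LeftOrders

/-! Isolation of `o` means that finitely many positive elements determine it. Let `x` be the base
point of the realization, so that `o` compares the points of the orbit of `x`. The finitely many
inequalities `x < ρ g x` persist at every `y` near `x`. Hence the order read off from the orbit of
`y` is again `o`, however the stabilizer of `y` is ordered. Ordering that stabilizer by the opposite
of `o` forces it to be trivial (`IsIsolated.eventually_apply_ne`). Minimality carries this to all
points by conjugation, so the action is free (`IsMinimalAction.apply_ne`).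

In a free action on the line every positive element moves all points to the right. The order is
therefore bi-invariant and archimedean, and density of an orbit makes it dense, so Hölder's theorem
embeds `G` in the reals with its order (`commute_of_archimedean`, `exists_real_embedding`). If two
values were rationally independent, a small multiple of a rational-linear functional could be added
to the embedding: the finitely many determining signs would survive but the order would change,
against isolation (`IsIsolated.exists_rat_mul`). So `G` has rank one and lies in the rationals; a
dense order is impossible on an infinite cyclic group of reals, and positive and negative rationals
have a common multiple up to sign, which leaves only two orders. -/

namespace LeftOrders

/-! ### Constructing left orders, and the local consequence of isolation -/

section constructions

variable {G : Type*} [Group G]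

/-- The left order with a given set of positive elements. -/
noncomputable def ofPositive (P : G → Prop) (hmul : ∀ f g, P f → P g → P (f * g)) (hone : ¬ P 1)
    (hinv : ∀ f, f ≠ 1 → (P f⁻¹ ↔ ¬ P f)) : LO G := by
  classical
  refine ⟨fun f => if P f.1 then 1 else -1, ?_, ?_⟩
  · intro f g hf hg
    have key : ∀ k : G, (if P k then (1 : ℤˣ) else -1) = 1 → P k := by
      intro k hk
      by_contra h
      rw [if_neg h] at hk
      exact absurd hk (by decide)
    have hfg := hmul _ _ (key _ hf) (key _ hg)
    exact ⟨fun h => hone (h ▸ hfg), if_pos hfg⟩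
  · intro f
    by_cases h : P f.1 <;> simp [hinv f.1 f.2, h]

theorem ordLT_one_ofPositive {P : G → Prop} {hmul hone hinv} (g : G) :
    ordLT (ofPositive P hmul hone hinv) 1 g ↔ P g := by
  classical
  constructor
  · rintro ⟨h, hg⟩
    by_contra hP
    have : (if P (1⁻¹ * g) then (1 : ℤˣ) else -1) = 1 := hg
    rw [inv_one, one_mul, if_neg hP] at this
    exact absurd this (by decide)
  · intro hP
    have hne : g ≠ 1 := fun h => hone (h ▸ hP)
    refine ⟨by simpa using hne, ?_⟩
    change (if P (1⁻¹ * g) then (1 : ℤˣ) else -1) = 1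
    rw [inv_one, one_mul, if_pos hP]

variable (o : LO G)

theorem ordLT_iff_one (f g : G) : ordLT o f g ↔ ordLT o 1 (f⁻¹ * g) := by
  rw [← lt_mul_left o f⁻¹, inv_mul_cancel]

theorem one_ordLT_mul {f g : G} (hf : ordLT o 1 f) (hg : ordLT o 1 g) : ordLT o 1 (f * g) := by
  refine lt_trans o hf ?_
  rwa [ordLT_iff_one, inv_mul_cancel_left]

theorem one_ordLT_inv (f : G) : ordLT o 1 f⁻¹ ↔ ordLT o f 1 := by
  rw [ordLT_iff_one o f 1, mul_one]

theorem one_ordLT_inv_iff_not {f : G} (hf : f ≠ 1) : ordLT o 1 f⁻¹ ↔ ¬ ordLT o 1 f := by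
  rw [one_ordLT_inv]
  refine ⟨fun h => lt_asymm o h, fun h => ?_⟩
  rcases lt_trichotomy o 1 f with h1 | h1 | h1
  · exact absurd h1 h
  · exact absurd h1.symm hf
  · exact h1

theorem one_ordLT_pow {f : G} (hf : ordLT o 1 f) (n : ℕ) : ordLT o 1 (f ^ (n + 1)) := by
  induction n with
  | zero => simpa using hf
  | succ n ih =>
    rw [pow_succ]
    exact one_ordLT_mul o ih hf

theorem exists_one_ordLT [Nontrivial G] : ∃ g, ordLT o 1 g := (exists_lt_lt o 1).1

theorem ordLT_one_iff_apply (g : G) (hg : g ≠ 1) : ordLT o 1 g ↔ o.1 ⟨g, hg⟩ = 1 := by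
  simp [ordLT, hg]

/-- Around an isolated left order, a left order is determined by finitely many of its positive
elements. -/
theorem IsIsolated.exists_finset {o : LO G} (hiso : IsIsolated o) :
    ∃ F : Finset G, (∀ g ∈ F, ordLT o 1 g) ∧ ∀ p : LO G, (∀ g ∈ F, ordLT p 1 g) → p = o := by
  classical
  obtain ⟨U, hU, hUo⟩ := isOpen_induced_iff.1 hiso
  have hoU : o.1 ∈ U := by
    have : o ∈ Subtype.val ⁻¹' U := by rw [hUo]; exact rfl
    exact this
  obtain ⟨I, u, hu, hIU⟩ := isOpen_pi_iff.1 hU o.1 hoU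
  -- A basic neighbourhood prescribes the signs on a finite set `I`. Inverting the negative elements
  -- of `I` turns these prescriptions into positivity conditions.
  refine ⟨I.image fun i => if ordLT o 1 i.1 then i.1 else i.1⁻¹, ?_, ?_⟩
  · intro g hg
    obtain ⟨i, -, rfl⟩ := Finset.mem_image.1 hg
    split_ifs with h
    · exact h
    · exact (one_ordLT_inv_iff_not o i.2).2 h
  · intro p hp
    have hpU : p ∈ Subtype.val ⁻¹' U := by
      refine hIU fun i hi => ?_
      have hpi := hp _ (Finset.mem_image_of_mem _ hi)
      have hiff : p.1 i = 1 ↔ o.1 i = 1 := by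
        have h1 := ordLT_one_iff_apply o i.1 i.2
        have h2 := ordLT_one_iff_apply p i.1 i.2
        rw [← h1, ← h2]
        split_ifs at hpi with h
        · exact ⟨fun _ => h, fun _ => hpi⟩
        · exact ⟨fun h3 => absurd h3 ((one_ordLT_inv_iff_not p i.2).1 hpi), fun h3 => absurd h3 h⟩
      have : p.1 i = o.1 i := by
        rcases Int.units_eq_one_or (p.1 i) with h1 | h1 <;>
          rcases Int.units_eq_one_or (o.1 i) with h2 | h2 <;> rw [h1, h2] at hiff ⊢ <;>
          revert hiff <;> decide
      rw [this]
      exact (hu i hi).2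
    rw [hUo] at hpU
    exact hpU

/-- The left order which compares the images of a point of the line and is completed by `o` on
the stabilizer of that point. -/
noncomputable def orderAt (ρ : G →* (ℝ ≃ₜ ℝ)) (hρ : ∀ g, StrictMono (ρ g)) (y : ℝ) : LO G :=
  ofPositive (fun g => y < ρ g y ∨ (ρ g y = y ∧ ordLT o 1 g))
    (by
      intro f g hf hg
      rw [map_mul, Homeomorph.mul_apply]
      rcases hg with hg | ⟨hg, hg'⟩
      · have := hρ f hg
        rcases hf with hf | ⟨hf, -⟩
        · exact Or.inl (hf.trans this)
        · exact Or.inl (by rwa [hf] at this)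
      · rw [hg]
        exact hf.imp id fun hf => ⟨hf.1, one_ordLT_mul o hf.2 hg'⟩)
    (by simp [lt_irrefl])
    (by
      intro f hf
      have hcancel : ρ f (ρ f⁻¹ y) = y := by
        rw [← Homeomorph.mul_apply, ← map_mul]; simp
      rw [one_ordLT_inv_iff_not o hf]
      have h1 : y < ρ f⁻¹ y ↔ ρ f y < y := by
        conv_rhs => rw [← hcancel, (hρ f).lt_iff_lt, hcancel]
      have h2 : ρ f⁻¹ y = y ↔ ρ f y = y := by
        rw [← (hρ f).injective.eq_iff, hcancel, eq_comm]
      rw [h1, h2]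
      rcases _root_.lt_trichotomy (ρ f y) y with h | h | h
      · simp [h, h.ne, h.le]
      · simp [h]
      · simp [h, h.ne', h.le])

/-- The opposite left order. -/
noncomputable def opposite : LO G :=
  ofPositive (fun g => ordLT o 1 g⁻¹)
    (by
      intro f g hf hg
      rw [mul_inv_rev]
      exact one_ordLT_mul o hg hf)
    (by simp [lt_irrefl])
    (fun f hf => one_ordLT_inv_iff_not o (inv_ne_one.2 hf))

/-- If `o` is isolated and compares the images of `x`, then no nontrivial element fixes a point
near `x`. -/
theorem IsIsolated.eventually_apply_ne {o : LO G} (hiso : IsIsolated o) (ρ : G →* (ℝ ≃ₜ ℝ))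
    (hρ : ∀ g, StrictMono (ρ g)) (x : ℝ) (hx : ∀ g, ordLT o 1 g → x < ρ g x) :
    ∀ᶠ y in nhds x, ∀ g, g ≠ 1 → ρ g y ≠ y := by
  obtain ⟨F, hF, hFo⟩ := hiso.exists_finset
  have hev : ∀ᶠ y in nhds x, ∀ g ∈ F, y < ρ g y := by
    rw [Filter.eventually_all_finset]
    intro g hg
    exact continuousAt_id.eventually_lt (ρ g).continuous.continuousAt (hx g (hF g hg))
  filter_upwards [hev] with y hy
  have hpos : ∀ g, ordLT o 1 g → ρ g y ≠ y := by
    intro g hg hgy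
    -- The elements of `F` move `y` strictly to the right, so they are positive whichever order
    -- completes the stabilizer of `y`. With the opposite of `o` as completion, an `o`-positive `g`
    -- fixing `y` would be negative for an order equal to `o`.
    have : orderAt (opposite o) ρ hρ y = o :=
      hFo _ fun k hk => (ordLT_one_ofPositive k).2 (Or.inl (hy k hk))
    rw [← this] at hg
    rcases (ordLT_one_ofPositive g).1 hg with h | ⟨-, h⟩
    · exact h.ne' hgy
    · have h1 := (ordLT_one_ofPositive g).1 h
      have h2 : ordLT (orderAt (opposite o) ρ hρ y) 1 g := hg
      rw [this] at h2
      rw [one_ordLT_inv] at h1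
      exact lt_asymm o h1 h2
  intro g hg hgy
  by_cases h : ordLT o 1 g
  · exact hpos g h hgy
  · refine hpos g⁻¹ ((one_ordLT_inv_iff_not o hg).2 h) ?_
    conv_lhs => rw [← hgy, ← Homeomorph.mul_apply, ← map_mul]
    simp

end constructions

/-! ### Free actions on the line -/

section free

variable {G : Type*} [Group G]

/-- A minimal action without nontrivial fixed points near some point is free. -/
theorem IsMinimalAction.apply_ne {ρ : G →* (ℝ ≃ₜ ℝ)} (hmin : IsMinimalAction ρ) {x : ℝ}
    (h : ∀ᶠ y in nhds x, ∀ g, g ≠ 1 → ρ g y ≠ y) (y : ℝ) (g : G) (hg : g ≠ 1) : ρ g y ≠ y := by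
  intro hgy
  -- The orbit of `y` enters the good neighbourhood of `x` at `ρ k y`, and this point is fixed by
  -- the conjugate `k * g * k⁻¹`.
  obtain ⟨_, hz, ⟨k, rfl⟩⟩ := mem_closure_iff_nhds.1 (hmin y x) _ h
  refine hz (k * g * k⁻¹) (by simpa using hg) ?_
  simp only [← Homeomorph.mul_apply, ← map_mul]
  rw [inv_mul_cancel_right, map_mul, Homeomorph.mul_apply, hgy]

/-- By the intermediate value theorem, a sign change of `f y - y` would produce a fixed point. -/
theorem lt_apply_of_forall_ne {f : ℝ → ℝ} (hf : Continuous f) (hne : ∀ y, f y ≠ y) {x : ℝ}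
    (hx : x < f x) (y : ℝ) : y < f y := by
  by_contra hy
  obtain ⟨z, hz⟩ := mem_range_of_exists_le_of_exists_ge (f := fun y => f y - y)
    (by fun_prop) (c := 0) ⟨y, by simpa using hy⟩ ⟨x, by simpa using hx.le⟩
  exact hne z (sub_eq_zero.1 hz)

/-- A bounded increasing orbit would converge to a fixed point of `f`. This is the source of the
archimedean property. -/
theorem exists_lt_iterate_of_forall_lt {f : ℝ → ℝ} (hf : Continuous f) (hlt : ∀ y, y < f y)
    (x z : ℝ) : ∃ n : ℕ, z < f^[n] x := by
  by_contra! h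
  have hmono : Monotone fun n => f^[n] x := monotone_nat_of_le_succ fun n => by
    rw [Function.iterate_succ_apply']
    exact (hlt _).le
  have hlim := tendsto_atTop_ciSup hmono ⟨z, by rintro _ ⟨n, rfl⟩; exact h n⟩
  exact (hlt _).ne' (isFixedPt_of_tendsto_iterate hlim hf.continuousAt)

theorem apply_pow_eq_iterate (ρ : G →* (ℝ ≃ₜ ℝ)) (g : G) (n : ℕ) (x : ℝ) :
    ρ (g ^ n) x = (ρ g)^[n] x := by
  induction n with
  | zero => simp
  | succ n ih => rw [pow_succ', map_mul, Homeomorph.mul_apply, ih, Function.iterate_succ_apply']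

end free

/-! ### Hölder's theorem -/

section holder

variable {G : Type*} [Group G] {o : LO G}

theorem mul_right_of_conj (hconj : ∀ g k, ordLT o 1 g → ordLT o 1 (k * g * k⁻¹)) {f g : G} (k : G)
    (h : ordLT o f g) : ordLT o (f * k) (g * k) := by
  rw [ordLT_iff_one] at h ⊢
  have := hconj _ k⁻¹ h
  simpa [mul_assoc] using this

/-- The order relation of a left order which is invariant on both sides, as a linear order. -/
noncomputable abbrev linearOrder (o : LO G) : LinearOrder G := by
  classical
  exact
    { le := fun f g => ¬ ordLT o g f
      lt := ordLT o
      le_refl := lt_irrefl o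
      le_trans := by
        intro a b c hab hbc hca
        rcases lt_trichotomy o a b with h | rfl | h
        · exact hbc (lt_trans o hca h)
        · exact hbc hca
        · exact hab h
      lt_iff_le_not_ge := fun a b => ⟨fun h => ⟨lt_asymm o h, fun h' => h' h⟩, fun h => by
        simpa using h.2⟩
      le_antisymm := by
        intro a b hab hba
        rcases lt_trichotomy o a b with h | h | h
        · exact absurd h hba
        · exact h
        · exact absurd h hab
      le_total := by
        intro a b
        by_cases h : ordLT o a b
        · exact Or.inl (lt_asymm o h)
        · exact Or.inr h
      toDecidableLE := Classical.decRel _ }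

end holder

/-- A densely ordered bi-ordered archimedean group is commutative. -/
theorem commute_of_archimedean {G : Type*} [Group G] [LinearOrder G] [MulLeftStrictMono G]
    [MulRightStrictMono G] (harch : ∀ g h : G, 1 < g → ∃ n : ℕ, h < g ^ n)
    (hdense : ∀ g : G, 1 < g → ∃ h, 1 < h ∧ h < g) (a b : G) : a * b = b * a := by
  classical
  have := mulLeftMono_of_mulLeftStrictMono G
  have := mulRightMono_of_mulRightStrictMono G
  -- An intermediate `d` splits `c` as `d * (d⁻¹ * c)` with both factors above `1`; the smaller
  -- factor has square at most `c`.
  have hhalf : ∀ c : G, 1 < c → ∃ d, 1 < d ∧ d ^ 2 ≤ c := by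
    intro c hc
    obtain ⟨d, hd1, hdc⟩ := hdense c hc
    have hq : 1 < d⁻¹ * c := by
      have := mul_lt_mul_right hdc d⁻¹
      rwa [inv_mul_cancel] at this
    rcases le_total d (d⁻¹ * c) with h | h
    · refine ⟨d, hd1, ?_⟩
      calc d ^ 2 = d * d := sq d
        _ ≤ d * (d⁻¹ * c) := by gcongr
        _ = c := mul_inv_cancel_left d c
    · refine ⟨d⁻¹ * c, hq, ?_⟩
      calc (d⁻¹ * c) ^ 2 = (d⁻¹ * c) * (d⁻¹ * c) := sq _
        _ ≤ d * (d⁻¹ * c) := by gcongr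
        _ = c := mul_inv_cancel_left d c
  have hfloor : ∀ d g : G, 1 < d → 1 < g → ∃ n : ℕ, d ^ n ≤ g ∧ g < d ^ (n + 1) := by
    intro d g hd hg
    have hex := harch d g hd
    have hspec := Nat.find_spec hex
    obtain ⟨n, hn⟩ : ∃ n, Nat.find hex = n + 1 := by
      refine Nat.exists_eq_succ_of_ne_zero fun h => ?_
      rw [h, pow_zero] at hspec
      exact absurd hspec hg.not_gt
    refine ⟨n, not_lt.1 (Nat.find_min hex (by omega)), by rwa [hn] at hspec⟩
  -- Were the commutator-like element `(b * a)⁻¹ * (a * b)` above `1`, some `d > 1` would have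
  -- square at most this element. Rounding `a` and `b` to powers of `d` costs less than two factors
  -- `d` in all, so `a * b` and `b * a` are too close for this.
  have hle : ∀ a b : G, 1 < a → 1 < b → a * b ≤ b * a := by
    intro a b ha hb
    by_contra! hab
    obtain ⟨d, hd, hdc⟩ := hhalf ((b * a)⁻¹ * (a * b)) (by
      have := mul_lt_mul_right hab (b * a)⁻¹
      rwa [inv_mul_cancel] at this)
    obtain ⟨m, hm1, hm2⟩ := hfloor d a hd ha
    obtain ⟨n, hn1, hn2⟩ := hfloor d b hd hb
    have h1 : a * b < d ^ (m + n + 2) := by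
      calc a * b < d ^ (m + 1) * d ^ (n + 1) := mul_lt_mul_of_lt_of_lt hm2 hn2
        _ = d ^ (m + n + 2) := by rw [← pow_add]; congr 1; omega
    have h2 : d ^ (m + n + 2) ≤ a * b := by
      calc d ^ (m + n + 2) = d ^ n * d ^ m * d ^ 2 := by
            rw [← pow_add, ← pow_add]; congr 1; omega
        _ ≤ b * a * ((b * a)⁻¹ * (a * b)) := by gcongr
        _ = a * b := mul_inv_cancel_left _ _
    exact absurd h1 h2.not_gt
  have hpos : ∀ a b : G, 1 < a → 1 < b → Commute a b := fun a b ha hb =>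
    le_antisymm (hle a b ha hb) (hle b a hb ha)
  have hinv : ∀ c : G, c < 1 → 1 < c⁻¹ := by
    intro c hc
    have := mul_lt_mul_right hc c⁻¹
    rwa [inv_mul_cancel, mul_one] at this
  rcases _root_.lt_trichotomy 1 a with ha | rfl | ha
  · rcases _root_.lt_trichotomy 1 b with hb | rfl | hb
    · exact hpos a b ha hb
    · simp
    · exact (Commute.inv_right_iff.1 (hpos a b⁻¹ ha (hinv b hb)))
  · simp
  · rcases _root_.lt_trichotomy 1 b with hb | rfl | hb
    · exact (Commute.inv_left_iff.1 (hpos a⁻¹ b (hinv a ha) hb))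
    · simp
    · exact Commute.inv_inv_iff.1 (hpos a⁻¹ b⁻¹ (hinv a ha) (hinv b hb))

/-- Hölder's theorem, for densely ordered groups. -/
theorem exists_real_embedding {G : Type*} [Group G] {o : LO G}
    (hconj : ∀ g k, ordLT o 1 g → ordLT o 1 (k * g * k⁻¹))
    (harch : ∀ g h, ordLT o 1 g → ∃ n : ℕ, ordLT o h (g ^ n))
    (hdense : ∀ g, ordLT o 1 g → ∃ h, ordLT o 1 h ∧ ordLT o h g) :
    ∃ φ : G →* Multiplicative ℝ, ∀ f g, ordLT o f g ↔ (φ f).toAdd < (φ g).toAdd := by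
  let _ : LinearOrder G := linearOrder o
  have hL : MulLeftStrictMono G := ⟨fun k _ _ h => (lt_mul_left o k).2 h⟩
  have hR : MulRightStrictMono G := ⟨fun k _ _ h => mul_right_of_conj hconj k h⟩
  -- Commutativity is added to the given group structure, so that the real embedding of archimedean
  -- ordered abelian groups applies to the same multiplication.
  let _ : CommGroup G :=
    { ‹Group G› with mul_comm := commute_of_archimedean harch hdense }
  have := mulRightMono_of_mulRightStrictMono G
  have : IsOrderedMonoid G :=
    { mul_le_mul_left := fun a b h c => mul_le_mul_left h c }
  have : MulArchimedean G := ⟨fun h g hg => (harch g h hg).imp fun n hn => le_of_lt hn⟩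
  obtain ⟨φ, hφ⟩ := Archimedean.exists_orderAddMonoidHom_real_injective (Additive G)
  refine ⟨⟨⟨fun g => Multiplicative.ofAdd (φ (Additive.ofMul g)), ?_⟩, ?_⟩, ?_⟩
  · exact congrArg Multiplicative.ofAdd (map_zero φ)
  · intro f g
    exact congrArg Multiplicative.ofAdd (map_add φ _ _)
  · intro f g
    exact ((OrderHomClass.monotone φ).strictMono_of_injective hφ).lt_iff_lt.symm

/-! ### Rank one, and subgroups of the rationals -/

section rank

variable {G : Type*} [Group G] {o : LO G}

/-- The left order defined by a homomorphism to the reals, and by `o` on its kernel. -/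
noncomputable def orderOfHom (o : LO G) (ψ : G →* Multiplicative ℝ) : LO G :=
  ofPositive (fun g => 0 < (ψ g).toAdd ∨ ((ψ g).toAdd = 0 ∧ ordLT o 1 g))
    (by
      intro f g hf hg
      rw [map_mul, toAdd_mul]
      rcases hf with hf | ⟨hf, hf'⟩ <;> rcases hg with hg | ⟨hg, hg'⟩
      · exact Or.inl (by linarith)
      · exact Or.inl (by linarith)
      · exact Or.inl (by linarith)
      · exact Or.inr ⟨by linarith, one_ordLT_mul o hf' hg'⟩)
    (by simp [lt_irrefl])
    (by
      intro f hf
      rw [one_ordLT_inv_iff_not o hf, map_inv, toAdd_inv]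
      rcases _root_.lt_trichotomy (ψ f).toAdd 0 with h | h | h
      · simp [h, h.ne, h.le]
      · simp [h]
      · simp [h, h.ne', h.le])

/-- An isolated order which comes from an embedding in the reals has rank one. -/
theorem IsIsolated.exists_rat_mul (hiso : IsIsolated o) (φ : G →* Multiplicative ℝ)
    (hφ : ∀ f g, ordLT o f g ↔ (φ f).toAdd < (φ g).toAdd) {g₀ : G} (hg₀ : ordLT o 1 g₀) (g : G) :
    ∃ q : ℚ, (φ g).toAdd = q * (φ g₀).toAdd := by
  by_contra hq
  set a := (φ g₀).toAdd with ha
  set b := (φ g).toAdd with hb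
  have ha0 : 0 < a := by simpa using (hφ 1 g₀).1 hg₀
  have hnot : b ∉ Submodule.span ℚ {a} := by
    rw [Submodule.mem_span_singleton]
    rintro ⟨q, hqb⟩
    exact hq ⟨q, by rw [← hqb, Rat.smul_def]⟩
  -- Since `b` is off the rational line of `a`, a functional kills `a` but not `b`; its sign can be
  -- chosen.
  obtain ⟨f, hfb, hfa⟩ : ∃ f : ℝ →ₗ[ℚ] ℚ, 0 < f b ∧ f a = 0 := by
    obtain ⟨f, hfb, hf⟩ := Submodule.exists_dual_map_eq_bot_of_notMem hnot inferInstance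
    have hfa : f a = 0 := by
      rw [← Submodule.mem_bot ℚ, ← hf]
      exact Submodule.mem_map_of_mem (Submodule.mem_span_singleton_self a)
    rcases hfb.lt_or_gt with h | h
    · exact ⟨-f, by simpa using h, by simpa using hfa⟩
    · exact ⟨f, h, hfa⟩
  obtain ⟨F, hF, hFo⟩ := hiso.exists_finset
  -- Only finitely many values matter, so continuity in `ε` suffices; `f` itself need not be
  -- continuous.
  have hev : ∀ᶠ ε : ℝ in nhds 0, ∀ k ∈ F, 0 < (φ k).toAdd + ε * f (φ k).toAdd := by
    rw [Filter.eventually_all_finset]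
    intro k hk
    have hc : ContinuousAt (fun ε : ℝ => (φ k).toAdd + ε * f (φ k).toAdd) 0 := by fun_prop
    refine continuousAt_const.eventually_lt hc ?_
    simpa using (hφ 1 k).1 (hF k hk)
  obtain ⟨ε, hε, hε0⟩ := ((hev.filter_mono nhdsWithin_le_nhds).and
    (self_mem_nhdsWithin (s := Set.Ioi (0 : ℝ)))).exists
  replace hε0 : 0 < ε := hε0
  let ψ : G →* Multiplicative ℝ :=
    { toFun := fun k => Multiplicative.ofAdd ((φ k).toAdd + ε * f (φ k).toAdd)
      map_one' := by simp
      map_mul' := fun k l => by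
        rw [← ofAdd_add, map_mul, toAdd_mul, map_add f]
        refine congrArg Multiplicative.ofAdd ?_
        push_cast
        ring }
  have hψ : ∀ k, (ψ k).toAdd = (φ k).toAdd + ε * f (φ k).toAdd := fun k => rfl
  have heq : orderOfHom o ψ = o :=
    hFo _ fun k hk => (ordLT_one_ofPositive k).2 (Or.inl (hε k hk))
  have hfb' : (0 : ℝ) < f b := by exact_mod_cast hfb
  -- The element `(g ^ n)⁻¹ * g₀ ^ m` will have `φ`-value in `(0, a]`, while the perturbation lowers
  -- it by `n * (ε * f b) ≥ 2 * a`. Its `ψ`-value is then negative, although it is positive for `o`.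
  obtain ⟨n, hn⟩ := Archimedean.arch (2 * a) (mul_pos hε0 hfb')
  rw [nsmul_eq_mul] at hn
  obtain ⟨m, ⟨hm1, hm2⟩, -⟩ := existsUnique_add_zsmul_mem_Ioc ha0 (-(n * b)) 0
  have hk : (φ ((g ^ n)⁻¹ * g₀ ^ m)).toAdd = -(n * b) + m • a := by
    simp [← ha, ← hb]
  have hkpos : ordLT o 1 ((g ^ n)⁻¹ * g₀ ^ m) := by
    rw [hφ, hk]
    simpa using hm1
  rw [← heq] at hkpos
  have hfk : f (-(n * b) + m • a) = -(n * f b) := by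
    rw [map_add, map_neg, ← nsmul_eq_mul, map_nsmul, map_zsmul, hfa]
    simp
  have hψk : (ψ ((g ^ n)⁻¹ * g₀ ^ m)).toAdd < 0 := by
    rw [hψ, hk, hfk]
    push_cast
    linarith
  rcases (ordLT_one_ofPositive _).1 hkpos with h | ⟨h, -⟩
  · exact absurd h hψk.not_gt
  · exact hψk.ne h

/-- A group with an embedding in the reals whose values are rational multiples of each other
is isomorphic to a subgroup of the rationals. -/
theorem exists_mulEquiv_addSubgroup_rat (φ : G →* Multiplicative ℝ) (hφ : Function.Injective φ)
    {a : ℝ} (ha : a ≠ 0) (h : ∀ g, ∃ q : ℚ, (φ g).toAdd = q * a) :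
    ∃ A : AddSubgroup ℚ, Nonempty (G ≃* Multiplicative A) := by
  choose q hq using h
  -- As `a ≠ 0`, the ratio `q g` is unique, and this makes the chosen ratios additive.
  let κ : Additive G →+ ℚ := AddMonoidHom.mk' (fun g => q g.toMul) fun f g => by
    have h1 : ((q (f + g).toMul : ℚ) : ℝ) * a = (q f.toMul + q g.toMul : ℚ) * a := by
      rw [← hq, toMul_add, map_mul, toAdd_mul, hq, hq]
      push_cast
      ring
    exact_mod_cast mul_right_cancel₀ ha h1
  have hκ : Function.Injective κ := fun f g hfg => by
    have h1 : q f.toMul = q g.toMul := hfg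
    have h2 : φ f.toMul = φ g.toMul := by
      apply Multiplicative.toAdd.injective
      rw [hq, hq, h1]
    exact hφ h2
  let E := AddMonoidHom.ofInjective hκ
  refine ⟨κ.range, ⟨⟨⟨fun g => Multiplicative.ofAdd (E (Additive.ofMul g)),
    fun x => (E.symm x.toAdd).toMul, fun g => ?_, fun x => ?_⟩, fun f g => ?_⟩⟩⟩
  · exact congrArg Additive.toMul (E.symm_apply_apply _)
  · exact congrArg Multiplicative.ofAdd (E.apply_symm_apply _)
  · exact congrArg Multiplicative.ofAdd (map_add E _ _)

/-- Writing `p = u / s` and `-q = v / t`, the multipliers `s * v` and `t * u` give `u * v - v * u =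
0`. They have the form `m + 1` and `n + 1` to record that they are nonzero. -/
theorem exists_pos_mul_add_eq_zero {p q : ℚ} (hp : 0 < p) (hq : q < 0) :
    ∃ m n : ℕ, ((m + 1 : ℕ) : ℚ) * p + ((n + 1 : ℕ) : ℚ) * q = 0 := by
  obtain ⟨u, hu⟩ := Int.eq_ofNat_of_zero_le (Rat.num_pos.2 hp).le
  obtain ⟨v, hv⟩ := Int.eq_ofNat_of_zero_le (Rat.num_pos.2 (neg_pos.2 hq)).le
  have hu0 : 0 < u := by have := Rat.num_pos.2 hp; omega
  have hv0 : 0 < v := by have := Rat.num_pos.2 (neg_pos.2 hq); omega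
  obtain ⟨m, hm⟩ := Nat.exists_eq_succ_of_ne_zero (Nat.mul_pos p.den_pos hv0).ne'
  obtain ⟨n, hn⟩ := Nat.exists_eq_succ_of_ne_zero (Nat.mul_pos (-q).den_pos hu0).ne'
  refine ⟨m, n, ?_⟩
  rw [Nat.succ_eq_add_one] at hm hn
  rw [← hm, ← hn]
  have h1 : p * p.den = u := by rw [Rat.mul_den_eq_num, hu]; rfl
  have h2 : (-q) * (-q).den = v := by rw [Rat.mul_den_eq_num, hv]; rfl
  push_cast
  linear_combination (v : ℚ) * h1 - (u : ℚ) * h2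

/-- A left order of a subgroup of the rationals is the natural order or its reverse. -/
theorem eq_or_eq_reverse_of_mulEquiv_rat [Nontrivial G] (o : LO G) {A : AddSubgroup ℚ}
    (φ : G ≃* Multiplicative A) :
    (∀ f g : G, ordLT o f g ↔ (φ f).toAdd < (φ g).toAdd) ∨
      (∀ f g : G, ordLT o f g ↔ (φ g).toAdd < (φ f).toAdd) := by
  -- Two positive elements with images of opposite sign would have positive powers whose product is
  -- trivial. Hence the image of a single positive element decides between the two orders.
  have hopp : ∀ f g, ordLT o 1 f → ordLT o 1 g → 0 < (φ f).toAdd → ¬ (φ g).toAdd < 0 := by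
    intro f g hf hg hf0 hg0
    obtain ⟨m, n, hmn⟩ := exists_pos_mul_add_eq_zero (p := (φ f).toAdd.1) (q := (φ g).toAdd.1)
      hf0 hg0
    have hpos := one_ordLT_mul o (one_ordLT_pow o hf m) (one_ordLT_pow o hg n)
    have hone : f ^ (m + 1) * g ^ (n + 1) = 1 := by
      apply φ.injective
      apply Multiplicative.toAdd.injective
      apply Subtype.ext
      rw [map_mul, map_pow, map_pow, map_one, toAdd_mul, toAdd_pow, toAdd_pow]
      simpa [nsmul_eq_mul] using hmn
    rw [hone] at hpos
    exact lt_irrefl o 1 hpos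
  have hne : ∀ g, g ≠ 1 → (φ g).toAdd ≠ 0 := fun g hg h => hg (φ.injective (by
    apply Multiplicative.toAdd.injective
    rw [h, map_one, toAdd_one]))
  have hne' : ∀ g, ordLT o 1 g → g ≠ 1 := by
    rintro _ hg rfl
    exact lt_irrefl o 1 hg
  obtain ⟨g₁, hg₁⟩ := exists_one_ordLT o
  have hinv : ∀ g, (φ g⁻¹).toAdd = -(φ g).toAdd := fun g => by rw [map_inv, toAdd_inv]
  rcases (hne g₁ (hne' g₁ hg₁)).lt_or_gt with h1 | h1
  · right
    have key : ∀ g, ordLT o 1 g → (φ g).toAdd < 0 := fun g hg =>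
      ((hne g (hne' g hg)).lt_or_gt).resolve_right fun h => hopp g g₁ hg hg₁ h h1
    intro f g
    have hsub : (φ (f⁻¹ * g)).toAdd = (φ g).toAdd - (φ f).toAdd := by
      rw [map_mul, toAdd_mul, hinv]; abel
    rw [ordLT_iff_one, ← sub_neg, ← hsub]
    refine ⟨key _, fun h => ?_⟩
    have hk : f⁻¹ * g ≠ 1 := fun hk => by rw [hk, map_one, toAdd_one] at h; exact h.false
    by_contra hn
    have := key _ ((one_ordLT_inv_iff_not o hk).2 hn)
    rw [hinv, neg_lt_zero] at this
    exact this.not_gt h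
  · left
    have key : ∀ g, ordLT o 1 g → 0 < (φ g).toAdd := fun g hg =>
      ((hne g (hne' g hg)).lt_or_gt).resolve_left fun h => hopp g₁ g hg₁ hg h1 h
    intro f g
    have hsub : (φ (f⁻¹ * g)).toAdd = (φ g).toAdd - (φ f).toAdd := by
      rw [map_mul, toAdd_mul, hinv]; abel
    rw [ordLT_iff_one, ← sub_pos, ← hsub]
    refine ⟨key _, fun h => ?_⟩
    have hk : f⁻¹ * g ≠ 1 := fun hk => by rw [hk, map_one, toAdd_one] at h; exact h.false
    by_contra hn
    have := key _ ((one_ordLT_inv_iff_not o hk).2 hn)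
    rw [hinv, neg_pos] at this
    exact this.not_gt h

/-- A densely ordered group of reals is not infinite cyclic. -/
theorem not_nonempty_mulEquiv_int [Nontrivial G] (φ : G →* Multiplicative ℝ)
    (hφ : ∀ f g, ordLT o f g ↔ (φ f).toAdd < (φ g).toAdd)
    (hdense : ∀ g, ordLT o 1 g → ∃ h, ordLT o 1 h ∧ ordLT o h g) :
    ¬ Nonempty (G ≃* Multiplicative ℤ) := by
  rintro ⟨E⟩
  have hgen : ∃ z, ordLT o 1 z ∧ ∀ g, ∃ n : ℤ, g = z ^ n := by
    have hz : ∀ g, ∃ n : ℤ, g = (E.symm (Multiplicative.ofAdd 1)) ^ n := fun g =>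
      ⟨(E g).toAdd, by
        rw [← map_zpow, MulEquiv.eq_symm_apply, ← ofAdd_zsmul, smul_eq_mul, mul_one, ofAdd_toAdd]⟩
    set z := E.symm (Multiplicative.ofAdd 1)
    by_cases h : ordLT o 1 z
    · exact ⟨z, h, hz⟩
    · have hz1 : z ≠ 1 := fun h1 => by
        obtain ⟨g, hg⟩ := exists_ne (1 : G)
        obtain ⟨n, hn⟩ := hz g
        exact hg (by rw [hn, h1, one_zpow])
      refine ⟨z⁻¹, (one_ordLT_inv_iff_not o hz1).2 h, fun g => ?_⟩
      obtain ⟨n, hn⟩ := hz g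
      exact ⟨-n, by simpa using hn⟩
  obtain ⟨z, hz1, hz⟩ := hgen
  -- An element strictly between `1` and the positive generator would be `z ^ n` with `0 < n < 1`.
  obtain ⟨h, h1, h2⟩ := hdense z hz1
  obtain ⟨n, rfl⟩ := hz h
  rw [hφ] at hz1 h1 h2
  rw [map_zpow, toAdd_zpow, zsmul_eq_mul] at h1 h2
  rw [map_one, toAdd_one] at hz1 h1
  have hn0 : (0 : ℝ) < n := pos_of_mul_pos_left h1 hz1.le
  have hn1 : (n : ℝ) < 1 := by
    by_contra! hc
    nlinarith
  have : 0 < n := by exact_mod_cast hn0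
  have : n < 1 := by exact_mod_cast hn1
  omega

end rank

end LeftOrders

/-! ### The main theorem -/

theorem theorem4p1 {G : Type*} [Group G] [Countable G]
    (o : LeftOrders.LO G) (hiso : LeftOrders.IsIsolated o)
    (e : ℕ ≃ G) (he : e 0 = 1) (x₀ : ℝ)
    (hmin : LeftOrders.IsMinimalAction (LeftOrders.dynamicalRealization o e x₀)) :
    ∃ A : AddSubgroup ℚ,
      ¬ Nonempty (A ≃+ ℤ) ∧
      Nonempty (G ≃* Multiplicative A) ∧
      ∀ φ : G ≃* Multiplicative A,
        (∀ f g : G, LeftOrders.ordLT o f g ↔ (φ f).toAdd < (φ g).toAdd) ∨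
        (∀ f g : G, LeftOrders.ordLT o f g ↔ (φ g).toAdd < (φ f).toAdd) := by
  open LeftOrders in
  have : Nontrivial G := e.symm.nontrivial
  have hspec := dynamicalRealization_spec o e x₀
  set ρ := dynamicalRealization o e x₀
  set x := iota o e x₀ 1
  have horb : ∀ g, ρ g x = iota o e x₀ g := fun g => by
    rw [hspec.apply_iota, mul_one]
  have hlt : ∀ f g, ordLT o f g ↔ ρ f x < ρ g x := fun f g => by
    rw [horb, horb, iota_lt_iff]
  have hone : ρ 1 x = x := by rw [map_one, Homeomorph.one_apply]
  have hfree := hmin.apply_ne (hiso.eventually_apply_ne ρ hspec.strictMono x fun g hg => by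
    rwa [hlt, hone] at hg)
  have hmove : ∀ g, ordLT o 1 g → ∀ y, y < ρ g y := by
    intro g hg
    have hg1 : g ≠ 1 := by
      rintro rfl
      exact lt_irrefl o 1 hg
    rw [hlt, hone] at hg
    exact lt_apply_of_forall_ne (ρ g).continuous (fun y => hfree y g hg1) hg
  have hconj : ∀ g k, ordLT o 1 g → ordLT o 1 (k * g * k⁻¹) := by
    intro g k hg
    rw [hlt, hone, map_mul, map_mul, Homeomorph.mul_apply, Homeomorph.mul_apply]
    -- Since `g` moves every point to the right, it does so at `ρ k⁻¹ x`; the increasing map `ρ k`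
    -- carries the inequality back to `x`.
    have := hspec.strictMono k (hmove g hg (ρ k⁻¹ x))
    rwa [← Homeomorph.mul_apply (ρ k) (ρ k⁻¹), ← map_mul, mul_inv_cancel, hone] at this
  have harch : ∀ g h, ordLT o 1 g → ∃ n : ℕ, ordLT o h (g ^ n) := by
    intro g h hg
    obtain ⟨n, hn⟩ := exists_lt_iterate_of_forall_lt (ρ g).continuous (hmove g hg) x (ρ h x)
    exact ⟨n, by rwa [hlt, apply_pow_eq_iterate]⟩
  have hdense : ∀ g, ordLT o 1 g → ∃ h, ordLT o 1 h ∧ ordLT o h g := by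
    intro g hg
    rw [hlt] at hg
    -- The dense orbit of `x` meets the interval from `x` to `ρ g x`, so the order on `G` has no
    -- least positive element.
    obtain ⟨_, ⟨h, rfl⟩, h1, h2⟩ := (hmin x).exists_between hg
    exact ⟨h, by rwa [hlt], by rwa [hlt]⟩
  obtain ⟨φ, hφ⟩ := exists_real_embedding hconj harch hdense
  obtain ⟨g₀, hg₀⟩ := exists_one_ordLT o
  have hinj : Function.Injective φ := by
    intro f g hfg
    rcases lt_trichotomy o f g with h | h | h
    · rw [hφ, hfg] at h
      exact absurd h (_root_.lt_irrefl _)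
    · exact h
    · rw [hφ, hfg] at h
      exact absurd h (_root_.lt_irrefl _)
  have hpos : 0 < (φ g₀).toAdd := by simpa using (hφ 1 g₀).1 hg₀
  obtain ⟨A, ⟨E⟩⟩ := exists_mulEquiv_addSubgroup_rat φ hinj hpos.ne'
    (hiso.exists_rat_mul φ hφ hg₀)
  refine ⟨A, ?_, ⟨E⟩, fun ψ => eq_or_eq_reverse_of_mulEquiv_rat o ψ⟩
  rintro ⟨Z⟩
  exact not_nonempty_mulEquiv_int φ hφ hdense ⟨E.trans (AddEquiv.toMultiplicative Z)⟩
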